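/- All Hilbert spaces are finite-dimensional and are written as $\mathbb{C}^A$ for a finite set $A$. A quantum channel is a completely positive trace-preserving linear map between the operator algebras of two such spaces, and a POVM is a finite family of positive semidefinite operators that sum to the identity. A quantum encryption of classical messages (QECM) is a tuple $Q=(M,K,\pi,H,\{\sigma^k_m\}_{k\in K,m\in M})$, where $M$ is a finite set of messages, $K$ is a measurable space of keys, $\pi$ is a probability measure on $K$, $H$ is a Hilbert space and the $\sigma^k_m$ are density operators on $H$, measurable in $k$. It is correct if there are POVMs $\{P^k_m\}_{m\in M}$ on $H$, $k\in K$, with $\int_K\operatorname{Tr}(P^k_m\sigma^k_m)\,d\pi(k)\ge 1$ for every $m\in M$. Let $N,s\in\mathbb{N}$ and let $\mathscr{F}$ be a class of quantum channels. A $1$-to-$s$ $N$-message cloning attack over $\mathscr{F}$ against $Q$ is a tuple $\mathcal A=(M_0,\{B_i\}_{i=1}^s,\{P^{i,k}_m\},\Phi)$, where $M_0\subseteq M$ has exactly $N$ elements, the $B_i$ are Hilbert spaces, $\{P^{i,k}_m\}_{m\in M_0}$ is a POVM on $B_i$ for all $i$ and $k$, measurable in $k$, and $\Phi:\mathcal{B}(H)\to\mathcal{B}(B_1\otimes\cdots\otimes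 B_s)$ is a channel in $\mathscr{F}$. The $1$-to-$s$ $N$-message cloning value of $Q$ over $\mathscr{F}$ is $$\mathfrak{c}^N_{1\to s}(Q|\mathscr{F})=\sup_{\mathcal A}\int_K\frac1N\sum_{m\in M_0}\operatorname{Tr}\big[(P^{1,k}_m\otimes\cdots\otimes P^{s,k}_m)\,\Phi(\sigma^k_m)\big]\,d\pi(k),$$ the supremum being over all such attacks (and $0$ if there are none). For $r\ge 1$ and $n\ge 0$, the rank-$r$ Haar-measure encryption of $n$ messages is the QECM $Q_{r,n}$ with messages $\{0,\dots,n-1\}$, keys $U$ in the unitary group $\mathcal{U}(rn)$ distributed by the Haar probability measure, codespace $\mathbb{C}^{rn}$ with basis $|0\rangle,\dots,|rn-1\rangle$, and ciphertexts $U\sigma_iU^*$, where $\sigma_i=\frac1r\sum_{j=ri}^{r(i+1)-1}|j\rangle\langle j|$. **Theorem.** Let $Q=(M,K,\pi,H,\{\sigma^k_m\})$ be a correct QECM and let $\mathscr{F}$ be a class of quantum channels such that for every $\Phi\in\mathscr{F}$ and every isometry $V$ into the input space of $\Phi$, the channel $\rho\mapsto\Phi(V\rho V^*)$ is in $\mathscr{F}$.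 Then, with $n=|M|$ and $r=\dim H-|M|+1$ (which is at least $1$, since $Q$ is correct), for all $N,s\in\mathbb{N}$, $$\mathfrak{c}^N_{1\to s}(Q_{r,n}|\mathscr{F})\le\mathfrak{c}^N_{1\to s}(Q|\mathscr{F}).$$ -/

import Mathlib

open MeasureTheory Matrix
open scoped ComplexOrder

namespace QEnc

noncomputable section

/-! Every (finite-dimensional) Hilbert space is written as `ℂ^A` for a finite set `A`, a register;
operators from `ℂ^A` to `ℂ^B` are the matrices with rows indexed by `B` and columns by `A`. -/

/-- Density operators on `ℂ^A`. -/
def IsState {A : Type} [Fintype A] (ρ : Matrix A A ℂ) : Prop :=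
  ρ.PosSemidef ∧ ρ.trace = 1

/-- A POVM on `ℂ^B` with outcomes in the finite set `ι`. -/
def IsPOVM {ι : Type*} [Fintype ι] {B : Type} [Fintype B] [DecidableEq B]
    (P : ι → Matrix B B ℂ) : Prop :=
  (∀ m, (P m).PosSemidef) ∧ ∑ m, P m = 1

/-- The map `Φ ⊗ id_k` on operators on `ℂ^A ⊗ ℂ^k`: it applies `Φ` to each of the `k × k` blocks. -/
def ampliation {A B : Type} (Φ : Matrix A A ℂ →ₗ[ℂ] Matrix B B ℂ) (k : ℕ)
    (X : Matrix (A × Fin k) (A × Fin k) ℂ) : Matrix (B × Fin k) (B × Fin k) ℂ :=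
  Matrix.of fun p q => Φ (Matrix.of fun a a' => X (a, p.2) (a', q.2)) p.1 q.1

/-- Quantum channels: completely positive trace-preserving maps `B(ℂ^A) → B(ℂ^B)`. -/
structure Channel (A B : Type) [Fintype A] [Fintype B] where
  toLin : Matrix A A ℂ →ₗ[ℂ] Matrix B B ℂ
  completelyPositive : ∀ (k : ℕ) (X : Matrix (A × Fin k) (A × Fin k) ℂ),
    X.PosSemidef → (ampliation toLin k X).PosSemidef
  tracePreserving : ∀ X : Matrix A A ℂ, (toLin X).trace = X.trace

/-- The linear map `ρ ↦ V ρ V*`. -/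
def conj {A A' : Type} [Fintype A] (V : Matrix A' A ℂ) :
    Matrix A A ℂ →ₗ[ℂ] Matrix A' A' ℂ where
  toFun X := V * X * Vᴴ
  map_add' X Y := by rw [Matrix.mul_add, Matrix.add_mul]
  map_smul' c X := by simp

theorem ampliation_conj {A A' : Type} [Fintype A] (V : Matrix A' A ℂ) (k : ℕ)
    (X : Matrix (A × Fin k) (A × Fin k) ℂ) :
    ampliation (conj V) k X =
      Matrix.kroneckerMap (· * ·) V (1 : Matrix (Fin k) (Fin k) ℂ) * X *
        (Matrix.kroneckerMap (· * ·) V (1 : Matrix (Fin k) (Fin k) ℂ))ᴴ := by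
  ext ⟨b, i⟩ ⟨b', j⟩
  simp [ampliation, conj, Matrix.mul_apply, Fintype.sum_prod_type, Matrix.one_apply,
    Finset.sum_ite_eq, apply_ite]

/-- The channel `ρ ↦ Φ(V ρ V*)` for an isometry `V : ℂ^A → ℂ^A'`. -/
def Channel.preIsometry {A A' B : Type} [Fintype A] [DecidableEq A] [Fintype A'] [Fintype B]
    (Φ : Channel A' B) (V : Matrix A' A ℂ) (hV : Vᴴ * V = 1) : Channel A B where
  toLin := Φ.toLin ∘ₗ conj V
  completelyPositive k X hX := by
    have h : (ampliation (conj V) k X).PosSemidef := by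
      rw [ampliation_conj]
      exact hX.mul_mul_conjTranspose_same _
    exact Φ.completelyPositive k _ h
  tracePreserving X := by
    have h : (V * X * Vᴴ).trace = X.trace := by
      rw [Matrix.trace_mul_comm, ← Matrix.mul_assoc, hV, Matrix.one_mul]
    exact (Φ.tracePreserving _).trans h

/-- A class of quantum channels. -/
def ChannelClass : Type 1 :=
  ∀ (A B : Type) [Fintype A] [Fintype B], Set (Channel A B)

/-- The class is closed under `Φ ↦ Φ(V · V*)` for every isometry `V`. -/
def ChannelClass.ClosedUnderIsometries (F : ChannelClass) : Prop :=
  ∀ (A A' B : Type) [Fintype A] [DecidableEq A] [Fintype A'] [Fintype B]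
    (Φ : Channel A' B) (V : Matrix A' A ℂ) (hV : Vᴴ * V = 1),
    Φ ∈ F A' B → Φ.preIsometry V hV ∈ F A B

/-- A quantum encryption of classical messages with set of messages `M`, space of keys `K` and
codespace `ℂ^A`. -/
structure QECM (M : Type*) (K : Type*) [MeasurableSpace K] (A : Type) [Fintype A] where
  /-- the key distribution -/
  keyDist : Measure K
  isProb : IsProbabilityMeasure keyDist
  /-- the ciphertexts -/
  cipher : K → M → Matrix A A ℂ
  isState : ∀ k m, IsState (cipher k m)
  measurable_cipher : ∀ m a a', Measurable fun k => cipher k m a a'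

/-- `ε`-correctness. For `ε < 1` the inequality forces the integrand to be integrable, since the
integral would otherwise be `0`. -/
def QECM.IsEpsCorrect {M K : Type*} [Fintype M] [MeasurableSpace K] {A : Type} [Fintype A]
    [DecidableEq A] (Q : QECM M K A) (ε : ℝ) : Prop :=
  ∃ P : K → M → Matrix A A ℂ, (∀ k, IsPOVM (P k)) ∧
    ∀ m, 1 - ε ≤ ∫ k, (P k m * Q.cipher k m).trace.re ∂Q.keyDist

/-- Correctness is `0`-correctness. -/
def QECM.IsCorrect {M K : Type*} [Fintype M] [MeasurableSpace K] {A : Type} [Fintype A]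
    [DecidableEq A] (Q : QECM M K A) : Prop :=
  Q.IsEpsCorrect 0

/-- The tensor product `P₀ ⊗ ⋯ ⊗ P₍ₛ₋₁₎` of operators `Pᵢ` on `ℂ^(B i)`, an operator on
`ℂ^(B 0) ⊗ ⋯ ⊗ ℂ^(B (s-1)) = ℂ^(B 0 × ⋯ × B (s-1))`. -/
def tensor {s : ℕ} {B : Fin s → Type} (P : ∀ i, Matrix (B i) (B i) ℂ) :
    Matrix (∀ i, B i) (∀ i, B i) ℂ :=
  Matrix.of fun x y => ∏ i, P i (x i) (y i)

/-- A `1`-to-`s` `N`-message cloning attack over `F` against a QECM with messages `M`, keys `K` and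
codespace `ℂ^A`. -/
structure Attack (M K : Type*) [MeasurableSpace K] (A : Type) [Fintype A]
    (F : ChannelClass) (N s : ℕ) where
  M₀ : Finset M
  card_M₀ : M₀.card = N
  /-- the registers of the receivers -/
  B : Fin s → Type
  fintypeB : ∀ i, Fintype (B i)
  decEqB : ∀ i, DecidableEq (B i)
  /-- the measurement of each receiver, given the key -/
  P : ∀ i, K → M₀ → Matrix (B i) (B i) ℂ
  isPOVM : ∀ i k, IsPOVM (P i k)
  measurable_P : ∀ i m b b', Measurable fun k => P i k m b b'
  Φ : Channel A (∀ i, B i)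
  mem : Φ ∈ F A (∀ i, B i)

/-- The cloning probability of an attack against a QECM. -/
def QECM.attackValue {M K : Type*} [MeasurableSpace K] {A : Type} [Fintype A]
    (Q : QECM M K A) {F : ChannelClass} {N s : ℕ} (𝒜 : Attack M K A F N s) : ℝ :=
  letI := 𝒜.fintypeB
  ∫ k, (1 / (N : ℝ)) * ∑ m : 𝒜.M₀,
    (tensor (fun i => 𝒜.P i k m) * 𝒜.Φ.toLin (Q.cipher k m)).trace.re ∂Q.keyDist

/-- The `1`-to-`s` `N`-message cloning value over `F`: the supremum of the cloning probabilities
(numbers in `[0, 1]`) over all attacks, which is `0` when there is no attack. -/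
def QECM.cloningValue {M K : Type*} [MeasurableSpace K] {A : Type} [Fintype A]
    (Q : QECM M K A) (F : ChannelClass) (N s : ℕ) : ℝ :=
  ⨆ 𝒜 : Attack M K A F N s, Q.attackValue 𝒜

/-! ### The Haar-measure encryption -/

instance unitaryMeasurableSpace (d : ℕ) : MeasurableSpace (unitaryGroup (Fin d) ℂ) := borel _

instance unitaryBorelSpace (d : ℕ) : BorelSpace (unitaryGroup (Fin d) ℂ) := ⟨rfl⟩

instance unitaryCompactSpace (d : ℕ) : CompactSpace (unitaryGroup (Fin d) ℂ) := by
  refine (isCompact_iff_compactSpace (s := (unitaryGroup (Fin d) ℂ : Set (Matrix (Fin d) (Fin d) ℂ)))).mp ?_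
  have hK : IsCompact (Set.univ.pi fun _ : Fin d => Set.univ.pi fun _ : Fin d =>
      Metric.closedBall (0 : ℂ) 1) :=
    isCompact_univ_pi fun _ => isCompact_univ_pi fun _ => isCompact_closedBall _ _
  refine IsCompact.of_isClosed_subset (X := Matrix (Fin d) (Fin d) ℂ) hK isClosed_unitary ?_
  intro U hU i _ j _
  simpa using entry_norm_bound_of_unitary hU i j

/-- The Haar probability measure on the unitary group `U(d)`. -/
def haarUnitary (d : ℕ) : Measure (unitaryGroup (Fin d) ℂ) :=
  Measure.haarMeasure ⊤

instance haarUnitary_isProb (d : ℕ) : IsProbabilityMeasure (haarUnitary d) :=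
  ⟨by simpa using! Measure.haarMeasure_self (K₀ := (⊤ : TopologicalSpace.PositiveCompacts
    (unitaryGroup (Fin d) ℂ)))⟩

/-- The state `(1/r) ∑_{j = r i}^{r (i + 1) - 1} |j⟩⟨j|` on `ℂ^(r n)`. -/
def blockState (r n : ℕ) (i : Fin n) : Matrix (Fin (r * n)) (Fin (r * n)) ℂ :=
  Matrix.diagonal fun j => if r * i.val ≤ j.val ∧ j.val < r * (i.val + 1) then (r : ℂ)⁻¹ else 0

theorem blockState_isState (r n : ℕ) [NeZero r] (i : Fin n) : IsState (blockState r n i) := by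
  constructor
  · refine PosSemidef.diagonal fun j => ?_
    dsimp only
    split_ifs
    · simp
    · exact le_rfl
  · have hle : r * (i.val + 1) ≤ r * n := Nat.mul_le_mul_left r i.isLt
    rw [blockState, Matrix.trace_diagonal, Fin.sum_univ_eq_sum_range
      (fun j => if r * i.val ≤ j ∧ j < r * (i.val + 1) then (r : ℂ)⁻¹ else 0) (r * n),
      ← Finset.sum_filter]
    have hf : (Finset.range (r * n)).filter (fun j => r * i.val ≤ j ∧ j < r * (i.val + 1)) =
        Finset.Ico (r * i.val) (r * (i.val + 1)) := by
      ext j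
      simp only [Finset.mem_filter, Finset.mem_range, Finset.mem_Ico]
      omega
    have hr : (r : ℂ) ≠ 0 := Nat.cast_ne_zero.mpr (NeZero.ne r)
    rw [hf, Finset.sum_const, Nat.card_Ico, Nat.mul_succ, Nat.add_sub_cancel_left, nsmul_eq_mul,
      mul_inv_cancel₀ hr]

/-- The rank-`r` Haar-measure encryption of `n` messages. -/
def haarEncryption (r n : ℕ) [NeZero r] :
    QECM (Fin n) (unitaryGroup (Fin (r * n)) ℂ) (Fin (r * n)) where
  keyDist := haarUnitary (r * n)
  isProb := inferInstance
  cipher U i := (U : Matrix (Fin (r * n)) (Fin (r * n)) ℂ) * blockState r n i *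
    (U : Matrix (Fin (r * n)) (Fin (r * n)) ℂ)ᴴ
  isState U i := by
    refine ⟨(blockState_isState r n i).1.mul_mul_conjTranspose_same _, ?_⟩
    have hU : (U : Matrix (Fin (r * n)) (Fin (r * n)) ℂ)ᴴ * U = 1 := mem_unitaryGroup_iff'.mp U.2
    rw [Matrix.trace_mul_comm, ← Matrix.mul_assoc, hU, Matrix.one_mul]
    exact (blockState_isState r n i).2
  measurable_cipher i a a' := by
    refine Continuous.measurable ?_
    have h : Continuous fun U : unitaryGroup (Fin (r * n)) ℂ =>
        (U : Matrix (Fin (r * n)) (Fin (r * n)) ℂ) * blockState r n i *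
          (U : Matrix (Fin (r * n)) (Fin (r * n)) ℂ)ᴴ :=
      (continuous_subtype_val.matrix_mul continuous_const).matrix_mul
        continuous_subtype_val.matrix_conjTranspose
    exact h.matrix_elem a a'

end

end QEnc

namespace QEnc

noncomputable section

/-! ### Positive semidefinite matrices -/

section PosSemidef

variable {n : Type*} [Fintype n]

/-! Averaging turns any correct encryption into the Haar encryption. Correctness makes the
ciphertexts of almost every key k mutually orthogonal (`QECM.IsCorrect.ae_orthogonal`), and n
orthogonal states of rank at least 1 fit into H only if each has rank at most r = dim H - n + 1
(`card_add_rank_le`). After an isometry V of H into ℂ^(rn), a unitary W_k therefore brings all V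
σ^k_m V* to diagonal form, the m-th supported in the m-th block of r basis vectors
(`exists_unitary_block_diagonal`). Summing such a diagonal state over the r cyclic shifts of the
blocks leaves r times the flat block state (`sum_submatrix_blockShift`).

Take an attack on the Haar encryption, and fix a unitary U and a shift T_t. Against Q, conjugate the
ciphertext by UV before the cloning channel, and let the receivers, who know k, measure with the key
U W_k T_t⁻¹ (`Attack.transport`). The new channel does not depend on k, and closure under isometries
keeps it in the class. Right invariance of the Haar measure lets U W_k T_t⁻¹ be renamed U; the input
is then a Haar encryption of the shifted diagonal states, and the average over U and t is exactly
the original value (`sum_integral_score_eq`). Each fixed pair (U, t) scores at most the cloning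
value of Q, so by Fubini the average does too; the class need not contain mixtures of channels.

The receivers' POVMs must be measurable in k, hence so must W_k; `exists_measurable_selection`
provides this by successive minimization on compact fibres. -/

open scoped MatrixOrder in
theorem PosSemidef.exists_eq_conjTranspose_mul_self {X : Matrix n n ℂ} (hX : X.PosSemidef) :
    ∃ B : Matrix n n ℂ, X = Bᴴ * B := by
  classical
  exact CStarAlgebra.nonneg_iff_eq_star_mul_self.mp hX.nonneg

theorem PosSemidef.trace_mul_nonneg {X Y : Matrix n n ℂ} (hX : X.PosSemidef)
    (hY : Y.PosSemidef) : 0 ≤ (X * Y).trace := by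
  obtain ⟨B, rfl⟩ := PosSemidef.exists_eq_conjTranspose_mul_self hX
  rw [Matrix.mul_assoc, Matrix.trace_mul_comm]
  exact (hY.mul_mul_conjTranspose_same B).trace_nonneg

/-- With X = B*B and Y = C*C, the trace of XY is the squared Hilbert–Schmidt norm of BC*. -/
theorem PosSemidef.mul_eq_zero_of_trace_eq_zero {X Y : Matrix n n ℂ} (hX : X.PosSemidef)
    (hY : Y.PosSemidef) (h : (X * Y).trace = 0) : X * Y = 0 := by
  obtain ⟨B, rfl⟩ := PosSemidef.exists_eq_conjTranspose_mul_self hX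
  obtain ⟨C, rfl⟩ := PosSemidef.exists_eq_conjTranspose_mul_self hY
  have h' : (B * Cᴴ * (B * Cᴴ)ᴴ).trace = 0 := by
    rw [← h, conjTranspose_mul, conjTranspose_conjTranspose,
      show Bᴴ * B * (Cᴴ * C) = Bᴴ * (B * (Cᴴ * C)) by simp only [Matrix.mul_assoc],
      Matrix.trace_mul_comm Bᴴ]
    simp only [Matrix.mul_assoc]
  rw [trace_mul_conjTranspose_self_eq_zero_iff] at h'
  rw [Matrix.mul_assoc, ← Matrix.mul_assoc B, h', Matrix.zero_mul, Matrix.mul_zero]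

end PosSemidef

/-! ### Tensor products of operators -/

section Tensor

variable {s : ℕ} {B : Fin s → Type}

theorem tensor_mul [∀ i, Fintype (B i)] (P R : ∀ i, Matrix (B i) (B i) ℂ) :
    tensor (fun i => P i * R i) = tensor P * tensor R := by
  ext x y
  simp only [tensor, Matrix.of_apply, Matrix.mul_apply, Finset.prod_univ_sum,
    Fintype.piFinset_univ, Finset.prod_mul_distrib]

theorem tensor_conjTranspose (P : ∀ i, Matrix (B i) (B i) ℂ) :
    tensor (fun i => (P i)ᴴ) = (tensor P)ᴴ := by
  ext x y
  simp [tensor]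

theorem tensor_one [∀ i, DecidableEq (B i)] :
    tensor (fun i => (1 : Matrix (B i) (B i) ℂ)) = 1 := by
  ext x y
  simp only [tensor, Matrix.of_apply, Matrix.one_apply]
  rw [Fintype.prod_ite_zero]
  simp [funext_iff]

theorem tensor_sum {ι : Type*} [Fintype ι] (P : ∀ i, ι → Matrix (B i) (B i) ℂ) :
    tensor (fun i => ∑ m, P i m) = ∑ f : Fin s → ι, tensor (fun i => P i (f i)) := by
  ext x y
  simp only [tensor, Matrix.of_apply, Matrix.sum_apply, Finset.prod_univ_sum,
    Fintype.piFinset_univ]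

theorem tensor_posSemidef [∀ i, Fintype (B i)] {P : ∀ i, Matrix (B i) (B i) ℂ} (hP : ∀ i, (P i).PosSemidef) :
    (tensor P).PosSemidef := by
  choose C hC using fun i => PosSemidef.exists_eq_conjTranspose_mul_self (hP i)
  rw [funext hC, tensor_mul, tensor_conjTranspose]
  exact posSemidef_conjTranspose_mul_self _

/-- Product effects over all tuples of outcomes sum to the identity; removing the constant tuple
leaves a sum of positive operators. -/
theorem one_sub_tensor_posSemidef [∀ i, Fintype (B i)] [∀ i, DecidableEq (B i)] {ι : Type*} [Fintype ι]
    {P : ∀ i, ι → Matrix (B i) (B i) ℂ} (hP : ∀ i, IsPOVM (P i)) (m : ι) :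
    (1 - tensor (fun i => P i m)).PosSemidef := by
  classical
  have h : ∑ f : Fin s → ι, tensor (fun i => P i (f i)) = 1 := by
    rw [← tensor_sum, ← tensor_one]
    exact congrArg tensor (funext fun i => (hP i).2)
  rw [← h, ← Finset.add_sum_erase _ _ (Finset.mem_univ fun _ : Fin s => m), add_sub_cancel_left]
  exact posSemidef_sum _ fun f _ => tensor_posSemidef fun i => (hP i).1 _

end Tensor

/-! ### Values of attacks -/

theorem Channel.posSemidef {A B : Type} [Fintype A] [Fintype B] (Φ : Channel A B)
    {ρ : Matrix A A ℂ} (hρ : ρ.PosSemidef) : (Φ.toLin ρ).PosSemidef :=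
  (Φ.completelyPositive 1 (ρ.submatrix Prod.fst Prod.fst) (hρ.submatrix _)).submatrix
    fun b => (b, 0)

theorem Channel.isState {A B : Type} [Fintype A] [Fintype B] (Φ : Channel A B)
    {ρ : Matrix A A ℂ} (hρ : IsState ρ) : IsState (Φ.toLin ρ) :=
  ⟨Φ.posSemidef hρ.1, (Φ.tracePreserving ρ).trans hρ.2⟩

theorem trace_tensor_mul_re_mem_Icc {s : ℕ} {B : Fin s → Type} [∀ i, Fintype (B i)]
    [∀ i, DecidableEq (B i)] {ι : Type*} [Fintype ι] {P : ∀ i, ι → Matrix (B i) (B i) ℂ}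
    (hP : ∀ i, IsPOVM (P i)) (m : ι) {ρ : Matrix (∀ i, B i) (∀ i, B i) ℂ} (hρ : IsState ρ) :
    (tensor (fun i => P i m) * ρ).trace.re ∈ Set.Icc 0 1 := by
  have h₀ := PosSemidef.trace_mul_nonneg (tensor_posSemidef fun i => (hP i).1 m) hρ.1
  have h₁ := PosSemidef.trace_mul_nonneg (one_sub_tensor_posSemidef hP m) hρ.1
  rw [Matrix.sub_mul, Matrix.one_mul, Matrix.trace_sub, hρ.2] at h₁
  exact ⟨(Complex.le_def.mp h₀).1, by simpa using (Complex.le_def.mp h₁).1⟩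

section Score

variable {M K : Type*} [MeasurableSpace K] {A : Type} [Fintype A] {F : ChannelClass} {N s : ℕ}

/-- The success probability of an attack on the ensemble of states `ρ`, given the key `k`. -/
def Attack.score (𝒜 : Attack M K A F N s) (k : K) (ρ : M → Matrix A A ℂ) : ℝ :=
  letI := 𝒜.fintypeB
  (1 / (N : ℝ)) * ∑ m : 𝒜.M₀, (tensor (fun i => 𝒜.P i k m) * 𝒜.Φ.toLin (ρ m)).trace.re

theorem QECM.attackValue_eq (Q : QECM M K A) (𝒜 : Attack M K A F N s) :
    Q.attackValue 𝒜 = ∫ k, 𝒜.score k (Q.cipher k) ∂Q.keyDist := rfl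

theorem Attack.score_mem_Icc (𝒜 : Attack M K A F N s) (k : K) {ρ : M → Matrix A A ℂ}
    (hρ : ∀ m, IsState (ρ m)) : 𝒜.score k ρ ∈ Set.Icc 0 1 := by
  let := 𝒜.fintypeB
  let := 𝒜.decEqB
  have h (m : 𝒜.M₀) := trace_tensor_mul_re_mem_Icc (P := fun i => 𝒜.P i k)
    (fun i => 𝒜.isPOVM i k) m (𝒜.Φ.isState (hρ m))
  refine ⟨mul_nonneg (by positivity) (Finset.sum_nonneg fun m _ => (h m).1), ?_⟩
  have hle : ∑ m : 𝒜.M₀, (tensor (fun i => 𝒜.P i k m) * 𝒜.Φ.toLin (ρ m)).trace.re ≤ N := by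
    refine (Finset.sum_le_sum fun m _ => (h m).2).trans ?_
    simp [𝒜.card_M₀]
  refine (mul_le_mul_of_nonneg_left hle (by positivity)).trans ?_
  rw [one_div]
  -- This covers N = 0 as well, where the inverse is 0 by convention.
  exact inv_mul_le_one

theorem Attack.score_norm_le (𝒜 : Attack M K A F N s) (k : K) {ρ : M → Matrix A A ℂ}
    (hρ : ∀ m, IsState (ρ m)) : ‖𝒜.score k ρ‖ ≤ 1 := by
  obtain ⟨h₀, h₁⟩ := 𝒜.score_mem_Icc k hρ
  rwa [Real.norm_of_nonneg h₀]

theorem QECM.attackValue_nonneg (Q : QECM M K A) (𝒜 : Attack M K A F N s) :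
    0 ≤ Q.attackValue 𝒜 :=
  integral_nonneg fun k => (𝒜.score_mem_Icc k (Q.isState k)).1

theorem QECM.attackValue_norm_le_one (Q : QECM M K A) (𝒜 : Attack M K A F N s) :
    ‖Q.attackValue 𝒜‖ ≤ 1 := by
  have := Q.isProb
  rw [Q.attackValue_eq]
  simpa using norm_integral_le_of_norm_le_const (μ := Q.keyDist) (C := 1)
    (.of_forall fun k => 𝒜.score_norm_le k (Q.isState k))

theorem QECM.cloningValue_nonneg (Q : QECM M K A) : 0 ≤ Q.cloningValue F N s :=
  Real.iSup_nonneg fun 𝒜 => Q.attackValue_nonneg 𝒜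

theorem QECM.attackValue_le_cloningValue (Q : QECM M K A) (𝒜 : Attack M K A F N s) :
    Q.attackValue 𝒜 ≤ Q.cloningValue F N s :=
  le_ciSup (f := fun 𝒜 : Attack M K A F N s => Q.attackValue 𝒜)
    ⟨1, by rintro _ ⟨ℬ, rfl⟩; exact (le_abs_self _).trans (Q.attackValue_norm_le_one ℬ)⟩ 𝒜

end Score

/-! ### Measurable selection from closed relations with compact fibres -/

section Selection

variable {X Y : Type*} [MeasurableSpace X] [TopologicalSpace Y]

/-- A closed-valued multifunction is measurable if its preimages of closed sets are. -/
structure IsMeasurableMultifunction (Γ : X → Set Y) : Prop where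
  isClosed : ∀ x, IsClosed (Γ x)
  measurableSet : ∀ C, IsClosed C → MeasurableSet {x | (Γ x ∩ C).Nonempty}

/-- The minimum over the fibre is attained in C exactly when, for every rational q, the fibre either
has no point with f ≤ q or has one in C. Countably many q suffice, and each condition is measurable
by hypothesis. -/
theorem IsMeasurableMultifunction.argmin [CompactSpace Y] {Γ : X → Set Y}
    (hΓ : IsMeasurableMultifunction Γ) {f : Y → ℝ} (hf : Continuous f) :
    IsMeasurableMultifunction fun x => {y ∈ Γ x | ∀ z ∈ Γ x, f y ≤ f z} where
  isClosed x := by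
    have : {y ∈ Γ x | ∀ z ∈ Γ x, f y ≤ f z} = Γ x ∩ ⋂ z ∈ Γ x, {y | f y ≤ f z} := by
      ext y; simp
    rw [this]
    exact (hΓ.isClosed x).inter
      (isClosed_biInter fun z _ => isClosed_le hf continuous_const)
  measurableSet C hC := by
    have hq (q : ℚ) : IsClosed {y | f y ≤ q} := isClosed_le hf continuous_const
    have : {x | ({y ∈ Γ x | ∀ z ∈ Γ x, f y ≤ f z} ∩ C).Nonempty} =
        {x | (Γ x ∩ C).Nonempty} ∩ ⋂ q : ℚ, ({x | (Γ x ∩ {y | f y ≤ q}).Nonempty}ᶜ ∪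
          {x | (Γ x ∩ (C ∩ {y | f y ≤ q})).Nonempty}) := by
      ext x
      simp only [Set.mem_ofPred_eq, Set.mem_inter_iff, Set.mem_iInter, Set.mem_union,
        Set.mem_compl_iff]
      constructor
      · rintro ⟨y, ⟨hy, hmin⟩, hyC⟩
        refine ⟨⟨y, hy, hyC⟩, fun q => or_iff_not_imp_left.mpr fun h => ?_⟩
        obtain ⟨z, hz, hzq⟩ := not_not.mp h
        exact ⟨y, hy, hyC, (hmin z hz).trans hzq⟩
      · rintro ⟨hne, h⟩
        obtain ⟨y, ⟨hy, hyC⟩, hmin⟩ :=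
          ((hΓ.isClosed x).inter hC).isCompact.exists_isMinOn hne hf.continuousOn
        refine ⟨y, ⟨hy, fun z hz => ?_⟩, hyC⟩
        by_contra! hlt
        obtain ⟨q, hzq, hqy⟩ := exists_rat_btwn hlt
        obtain h | ⟨w, hw, hwC, hwq⟩ := h q
        · exact h ⟨z, hz, hzq.le⟩
        · exact absurd (hmin ⟨hw, hwC⟩) (not_le.mpr (lt_of_le_of_lt hwq hqy))
    rw [this]
    exact (hΓ.measurableSet C hC).inter (MeasurableSet.iInter fun q =>
      (hΓ.measurableSet _ (hq q)).compl.union (hΓ.measurableSet _ (hC.inter (hq q))))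

/-- Lexicographic minimization: each function of the list in turn cuts the fibre down to its
minimizers, which exist by compactness, and is constant from then on. -/
theorem IsMeasurableMultifunction.exists_refinement [CompactSpace Y] (l : List (Y → ℝ))
    (hl : ∀ f ∈ l, Continuous f) {Γ : X → Set Y} (hΓ : IsMeasurableMultifunction Γ) :
    ∃ Γ' : X → Set Y, IsMeasurableMultifunction Γ' ∧ ∀ x, Γ' x ⊆ Γ x ∧
      ((Γ x).Nonempty → (Γ' x).Nonempty) ∧ ∀ f ∈ l, ∀ y ∈ Γ' x, ∀ z ∈ Γ' x, f y = f z := by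
  induction l generalizing Γ with
  | nil => exact ⟨Γ, hΓ, fun x => ⟨subset_rfl, id, by simp⟩⟩
  | cons f l ih =>
    have hf := hl f (by simp)
    obtain ⟨Γ', hΓ', h⟩ := ih (fun g hg => hl g (by simp [hg])) (hΓ.argmin hf)
    refine ⟨Γ', hΓ', fun x => ⟨(h x).1.trans fun y hy => hy.1, fun hne => (h x).2.1 ?_, ?_⟩⟩
    · obtain ⟨y, hy, hmin⟩ := (hΓ.isClosed x).isCompact.exists_isMinOn hne hf.continuousOn
      exact ⟨y, hy, fun z hz => hmin hz⟩
    · intro g hg y hy z hz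
      rcases List.mem_cons.mp hg with rfl | hg
      · exact le_antisymm (((h x).1 hy).2 z ((h x).1 hz).1) (((h x).1 hz).2 y ((h x).1 hy).1)
      · exact (h x).2.2 g hg y hy z hz

/-- A closed relation over a compact space whose points are separated by finitely many continuous
functions has a measurable selection. -/
theorem exists_measurable_selection [TopologicalSpace X] [OpensMeasurableSpace X]
    [CompactSpace Y] [MeasurableSpace Y] [BorelSpace Y] [Nonempty Y]
    (l : List (Y → ℝ)) (hl : ∀ f ∈ l, Continuous f)
    (hsep : ∀ y z, (∀ f ∈ l, f y = f z) → y = z) {R : Set (X × Y)} (hR : IsClosed R) :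
    ∃ S : X → Y, Measurable S ∧ ∀ x, (∃ y, (x, y) ∈ R) → (x, S x) ∈ R := by
  classical
  -- Projecting a closed set along a compact factor gives a closed set, which is measurable.
  have hΓ : IsMeasurableMultifunction fun x => {y | (x, y) ∈ R} :=
    { isClosed := fun x => hR.preimage (by fun_prop)
      measurableSet := fun C hC => by
        have : {x | ({y | (x, y) ∈ R} ∩ C).Nonempty} = Prod.fst '' (R ∩ Prod.snd ⁻¹' C) := by
          ext x
          constructor
          · rintro ⟨y, hy, hyC⟩
            exact ⟨(x, y), ⟨hy, hyC⟩, rfl⟩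
          · rintro ⟨⟨x, y⟩, ⟨hy, hyC⟩, rfl⟩
            exact ⟨y, hy, hyC⟩
        rw [this]
        exact (isClosedMap_fst_of_compactSpace _
          (hR.inter (hC.preimage continuous_snd))).measurableSet }
  obtain ⟨Γ, hΓ', h⟩ := hΓ.exists_refinement l hl
  -- The separating functions are constant on the refined fibres, so these have at most one point
  -- and the selection is forced; `y₀` is only a default on empty fibres.
  have hsub (x : X) {y z : Y} (hy : y ∈ Γ x) (hz : z ∈ Γ x) : y = z :=
    hsep y z fun f hf => (h x).2.2 f hf y hy z hz
  let y₀ : Y := Classical.arbitrary Y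
  let S : X → Y := fun x => if hx : (Γ x).Nonempty then hx.some else y₀
  have hS (x : X) (hx : (Γ x).Nonempty) : S x ∈ Γ x := by
    simp only [S, dif_pos hx]
    exact hx.some_mem
  refine ⟨S, measurable_of_isClosed fun C hC => ?_, fun x hx => (h x).1 (hS x ((h x).2.1 hx))⟩
  have : S ⁻¹' C = {x | (Γ x ∩ C).Nonempty} ∪
      ({x | (Γ x ∩ Set.univ).Nonempty}ᶜ ∩ {_x | y₀ ∈ C}) := by
    ext x
    simp only [Set.mem_preimage, Set.mem_union, Set.mem_inter_iff, Set.mem_compl_iff,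
      Set.mem_ofPred_eq, Set.inter_univ]
    by_cases hx : (Γ x).Nonempty
    · simp only [hx, not_true_eq_false, false_and, or_false]
      constructor
      · exact fun hC => ⟨S x, hS x hx, hC⟩
      · rintro ⟨y, hy, hyC⟩
        rwa [hsub x (hS x hx) hy]
    · have hxC : ¬ (Γ x ∩ C).Nonempty := fun h => hx (h.mono Set.inter_subset_left)
      simp [S, hx, hxC]
  rw [this]
  exact (hΓ'.measurableSet C hC).union
    ((hΓ'.measurableSet _ isClosed_univ).compl.inter (MeasurableSet.const _))

end Selection

/-! ### Mutually orthogonal Hermitian matrices -/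

section Diagonalization

variable {ι M : Type*} [Fintype ι] [DecidableEq ι]

theorem toEuclideanLin_eigenvectorBasis {τ : Matrix ι ι ℂ} (hτ : τ.IsHermitian) (a : ι) :
    toEuclideanLin τ (hτ.eigenvectorBasis a) =
      (hτ.eigenvalues a : ℂ) • hτ.eigenvectorBasis a := by
  ext i
  simpa using congrFun (hτ.mulVec_eigenvectorBasis a) i

/-- For eigenvectors v, w of distinct matrices with nonzero eigenvalues a, b, the number ab⟨v, w⟩
equals ⟨v, τ_m τ_m' w⟩ = 0. Kernels carry no such relation, hence the restriction to nonzero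
eigenvalues. -/
theorem orthonormal_eigenvectors {τ : M → Matrix ι ι ℂ} (hτ : ∀ m, (τ m).IsHermitian)
    (horth : ∀ m m', m ≠ m' → τ m * τ m' = 0) :
    Orthonormal ℂ fun p : Σ m, {a // (hτ m).eigenvalues a ≠ 0} =>
      (hτ p.1).eigenvectorBasis p.2 := by
  classical
  rw [orthonormal_iff_ite]
  rintro ⟨m, a, ha⟩ ⟨m', a', ha'⟩
  by_cases hm : m = m'
  · subst hm
    rw [orthonormal_iff_ite.mp (hτ m).eigenvectorBasis.orthonormal]
    simp
  · rw [if_neg (by simp [hm])]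
    have h : inner ℂ (toEuclideanLin (τ m) ((hτ m).eigenvectorBasis a))
        (toEuclideanLin (τ m') ((hτ m').eigenvectorBasis a')) = 0 := by
      rw [isSymmetric_toEuclideanLin_iff.mpr (hτ m)]
      have : toEuclideanLin (τ m) (toEuclideanLin (τ m') ((hτ m').eigenvectorBasis a')) = 0 := by
        ext i
        simp [horth m m' hm]
      rw [this, inner_zero_right]
    rw [toEuclideanLin_eigenvectorBasis, toEuclideanLin_eigenvectorBasis, inner_smul_left,
      inner_smul_right] at h
    simpa [ha, ha'] using h

theorem sum_rank_le_card [Fintype M] {τ : M → Matrix ι ι ℂ} (hτ : ∀ m, (τ m).IsHermitian)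
    (horth : ∀ m m', m ≠ m' → τ m * τ m' = 0) : ∑ m, (τ m).rank ≤ Fintype.card ι := by
  classical
  have h := (orthonormal_eigenvectors hτ horth).linearIndependent.fintype_card_le_finrank
  rw [finrank_euclideanSpace, Fintype.card_sigma] at h
  simpa only [(hτ _).rank_eq_card_non_zero_eigs] using h

/-- Mutually orthogonal Hermitian matrices of rank at most `r` are diagonalized by a common unitary
which moves the support of each of them into a prescribed block of size `r`. -/
theorem exists_unitary_block_diagonal {r : ℕ} (e : M × Fin r ≃ ι) {τ : M → Matrix ι ι ℂ}
    (hτ : ∀ m, (τ m).IsHermitian) (horth : ∀ m m', m ≠ m' → τ m * τ m' = 0)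
    (hrank : ∀ m, (τ m).rank ≤ r) :
    ∃ W ∈ unitaryGroup ι ℂ, ∀ m i j, ¬(i = j ∧ (e.symm i).1 = m) →
      (Wᴴ * τ m * W) i j = 0 := by
  classical
  have hemb (m : M) : Nonempty ({a // (hτ m).eigenvalues a ≠ 0} ↪ Fin r) := by
    refine Function.Embedding.nonempty_of_card_le ?_
    rw [← (hτ m).rank_eq_card_non_zero_eigs, Fintype.card_fin]
    exact hrank m
  -- The eigenvectors of each matrix get distinct positions inside its own block; unused positions
  -- are filled later by extending to an orthonormal basis.
  let g : (Σ m, {a // (hτ m).eigenvalues a ≠ 0}) → ι := fun p => e (p.1, (hemb p.1).some p.2)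
  have hg : Function.Injective g := by
    rintro ⟨m, a⟩ ⟨m', a'⟩ h
    have h' := e.injective h
    simp only [Prod.mk.injEq] at h'
    obtain ⟨rfl, h'⟩ := h'
    rw [(hemb m).some.injective h']
  let v : ι → EuclideanSpace ℂ ι :=
    Function.extend g (fun p => (hτ p.1).eigenvectorBasis p.2) 0
  have hv (p) : v (g p) = (hτ p.1).eigenvectorBasis p.2 := hg.extend_apply _ _ p
  have horthv : Orthonormal ℂ ((Set.range g).domRestrict v) := by
    have h := (orthonormal_eigenvectors hτ horth).comp (Equiv.ofInjective g hg).symm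
      (Equiv.injective _)
    convert h using 1
    funext x
    rw [Function.comp_apply, ← hv, Equiv.apply_ofInjective_symm hg, Set.domRestrict_apply]
  obtain ⟨b, hb⟩ := horthv.exists_orthonormalBasis_extension_of_card_eq finrank_euclideanSpace
  have hbg (p) : b (g p) = (hτ p.1).eigenvectorBasis p.2 := (hb _ ⟨p, rfl⟩).trans (hv p)
  -- Every vector of the extended basis is an eigenvector of every matrix. Those at unused positions
  -- are orthogonal to all eigenvectors with nonzero eigenvalue, so every matrix kills them.
  have hT (m : M) (j : ι) : ∃ c : ℂ, toEuclideanLin (τ m) (b j) = c • b j ∧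
      ((e.symm j).1 ≠ m → c = 0) := by
    by_cases hj : j ∈ Set.range g
    · obtain ⟨p, rfl⟩ := hj
      by_cases hm : p.1 = m
      · subst hm
        exact ⟨_, by rw [hbg, toEuclideanLin_eigenvectorBasis], fun h => absurd (by simp [g]) h⟩
      · refine ⟨0, ?_, fun _ => rfl⟩
        have h : (hτ p.1).eigenvectorBasis p.2 =
            ((hτ p.1).eigenvalues p.2 : ℂ)⁻¹ •
              toEuclideanLin (τ p.1) ((hτ p.1).eigenvectorBasis p.2) := by
          rw [toEuclideanLin_eigenvectorBasis, smul_smul, inv_mul_cancel₀, one_smul]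
          exact_mod_cast p.2.2
        rw [hbg, h, map_smul, zero_smul]
        have : toEuclideanLin (τ m) (toEuclideanLin (τ p.1)
            ((hτ p.1).eigenvectorBasis p.2)) = 0 := by
          ext i
          simp [horth m p.1 (Ne.symm hm)]
        rw [this, smul_zero]
    · refine ⟨0, ?_, fun _ => rfl⟩
      rw [zero_smul]
      refine InnerProductSpace.ext_inner_left_basis (hτ m).eigenvectorBasis.toBasis fun a => ?_
      rw [OrthonormalBasis.coe_toBasis, inner_zero_right,
        ← isSymmetric_toEuclideanLin_iff.mpr (hτ m), toEuclideanLin_eigenvectorBasis,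
        inner_smul_left]
      by_cases ha : (hτ m).eigenvalues a = 0
      · simp [ha]
      · have hne : g ⟨m, a, ha⟩ ≠ j := fun h => hj ⟨_, h⟩
        have h : inner ℂ (b (g ⟨m, a, ha⟩)) (b j) = 0 := b.orthonormal.2 hne
        rw [hbg] at h
        rw [h, mul_zero]
  let W : Matrix ι ι ℂ := Matrix.of fun i j => b j i
  have hWτ (X : Matrix ι ι ℂ) (i j : ι) :
      (Wᴴ * X * W) i j = inner ℂ (b i) (toEuclideanLin X (b j)) := by
    rw [Matrix.mul_assoc]
    simp only [W, Matrix.mul_apply, EuclideanSpace.inner_eq_star_dotProduct, dotProduct,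
      Matrix.conjTranspose_apply, Matrix.of_apply, toLpLin_apply, mulVec, Pi.star_apply]
    exact Finset.sum_congr rfl fun k _ => mul_comm _ _
  refine ⟨W, ?_, fun m i j hij => ?_⟩
  · rw [mem_unitaryGroup_iff']
    ext i j
    have h := hWτ 1 i j
    rw [Matrix.mul_one] at h
    rw [star_eq_conjTranspose, h, Matrix.one_apply, ← orthonormal_iff_ite.mp b.orthonormal i j]
    simp
  · rw [hWτ]
    obtain ⟨c, hc, hc0⟩ := hT m j
    rw [hc, inner_smul_right, orthonormal_iff_ite.mp b.orthonormal i j]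
    by_cases h : i = j
    · subst h
      rw [hc0 fun h => hij ⟨rfl, h⟩, zero_mul]
    · rw [if_neg h, mul_zero]

end Diagonalization

/-! ### Correct encryptions -/

section Correct

variable {M : Type*} [Fintype M] {A : Type} [Fintype A] [DecidableEq A]

theorem one_sub_posSemidef {P : M → Matrix A A ℂ} (hP : IsPOVM P) (m : M) :
    (1 - P m).PosSemidef := by
  classical
  rw [← hP.2, ← Finset.add_sum_erase _ _ (Finset.mem_univ m), add_sub_cancel_left]
  exact posSemidef_sum _ fun _ _ => hP.1 _

theorem trace_mul_re_le_one {P : M → Matrix A A ℂ} (hP : IsPOVM P) (m : M) {ρ : Matrix A A ℂ}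
    (hρ : IsState ρ) : (P m * ρ).trace.re ≤ 1 := by
  have h := PosSemidef.trace_mul_nonneg (one_sub_posSemidef hP m) hρ.1
  rw [Matrix.sub_mul, Matrix.one_mul, Matrix.trace_sub, hρ.2] at h
  simpa using (Complex.le_def.mp h).1

/-- A state which a POVM identifies with certainty is fixed by the corresponding effect. -/
theorem mul_eq_self_of_trace_re_eq_one {P : M → Matrix A A ℂ} (hP : IsPOVM P) {m : M}
    {ρ : Matrix A A ℂ} (hρ : IsState ρ) (h : (P m * ρ).trace.re = 1) : P m * ρ = ρ := by
  have h₀ := PosSemidef.trace_mul_nonneg (hP.1 m) hρ.1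
  have h₁ : (P m * ρ).trace = 1 := Complex.ext (by simpa using h) (Complex.le_def.mp h₀).2.symm
  have h₂ : (1 - P m) * ρ = 0 := by
    refine PosSemidef.mul_eq_zero_of_trace_eq_zero (one_sub_posSemidef hP m) hρ.1 ?_
    rw [Matrix.sub_mul, Matrix.one_mul, Matrix.trace_sub, hρ.2, h₁, sub_self]
  rw [Matrix.sub_mul, Matrix.one_mul, sub_eq_zero] at h₂
  exact h₂.symm

/-- States which a POVM distinguishes with certainty are mutually orthogonal. -/
theorem mul_eq_zero_of_trace_re_eq_one {P : M → Matrix A A ℂ} (hP : IsPOVM P)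
    {ρ : M → Matrix A A ℂ} (hρ : ∀ m, IsState (ρ m)) (h : ∀ m, (P m * ρ m).trace.re = 1)
    {m m' : M} (hm : m ≠ m') : ρ m * ρ m' = 0 := by
  classical
  have hfix (m : M) := mul_eq_self_of_trace_re_eq_one hP (hρ m) (h m)
  have hzero : P m * ρ m' = 0 := by
    refine PosSemidef.mul_eq_zero_of_trace_eq_zero (hP.1 m) (hρ m').1 ?_
    have hsum : ∑ j ∈ Finset.univ.erase m', (P j * ρ m').trace = 0 := by
      have h₁ : ∑ j, (P j * ρ m').trace = (P m' * ρ m').trace := by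
        rw [← Matrix.trace_sum, ← Finset.sum_mul, hP.2, Matrix.one_mul, hfix]
      rw [← Finset.add_sum_erase _ _ (Finset.mem_univ m')] at h₁
      exact add_eq_left.mp h₁
    exact (Finset.sum_eq_zero_iff_of_nonneg fun j _ =>
      PosSemidef.trace_mul_nonneg (hP.1 j) (hρ m').1).mp hsum m (by simp [hm])
  have hleft : ρ m * P m = ρ m := by
    simpa [Matrix.conjTranspose_mul, (hP.1 m).isHermitian.eq, (hρ m).1.isHermitian.eq] using
      congrArg conjTranspose (hfix m)
  rw [← hleft, Matrix.mul_assoc, hzero, Matrix.mul_zero]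

theorem QECM.IsCorrect.ae_orthogonal {K : Type*} [MeasurableSpace K] {Q : QECM M K A}
    (hQ : Q.IsCorrect) :
    ∀ᵐ k ∂Q.keyDist, ∀ m m', m ≠ m' → Q.cipher k m * Q.cipher k m' = 0 := by
  have := Q.isProb
  obtain ⟨P, hP, hint⟩ := hQ
  have hae : ∀ᵐ k ∂Q.keyDist, ∀ m, (P k m * Q.cipher k m).trace.re = 1 := by
    refine ae_all_iff.mpr fun m => ?_
    have hm := hint m
    rw [sub_zero] at hm
    -- The POVM is not assumed measurable in the key, so integrability comes from correctness
    -- itself: a non-integrable function would have integral 0, not at least 1.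
    have hi : Integrable (fun k => (P k m * Q.cipher k m).trace.re) Q.keyDist := by
      by_contra h
      rw [integral_undef h] at hm
      norm_num at hm
    have hnonneg (k : K) : 0 ≤ 1 - (P k m * Q.cipher k m).trace.re :=
      sub_nonneg.mpr (trace_mul_re_le_one (hP k) m (Q.isState k m))
    have hzero : ∫ k, (1 - (P k m * Q.cipher k m).trace.re) ∂Q.keyDist = 0 := by
      refine le_antisymm ?_ (integral_nonneg hnonneg)
      rw [integral_sub (integrable_const _) hi]
      simpa using hm
    filter_upwards [(integral_eq_zero_iff_of_nonneg hnonneg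
      ((integrable_const _).sub hi)).mp hzero] with k hk
    exact (sub_eq_zero.mp hk).symm
  filter_upwards [hae] with k hk m m' hm
  exact mul_eq_zero_of_trace_re_eq_one (hP k) (Q.isState k) hk hm

theorem IsState.one_le_rank {ρ : Matrix A A ℂ} (hρ : IsState ρ) : 1 ≤ ρ.rank := by
  rw [hρ.1.isHermitian.rank_eq_card_non_zero_eigs, Nat.one_le_iff_ne_zero, Ne,
    Fintype.card_eq_zero_iff]
  intro h
  have h₀ : hρ.1.isHermitian.eigenvalues = 0 := by
    funext a
    by_contra ha
    exact h.false ⟨a, ha⟩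
  have h₁ := hρ.2
  rw [hρ.1.isHermitian.eigenvalues_eq_zero_iff.mp h₀] at h₁
  simp at h₁

/-- The other |M| - 1 states use at least one dimension each; this is where the block size of the
theorem comes from. -/
theorem card_add_rank_le {ρ : M → Matrix A A ℂ} (hρ : ∀ m, IsState (ρ m))
    (horth : ∀ m m', m ≠ m' → ρ m * ρ m' = 0) (m : M) :
    Fintype.card M + (ρ m).rank ≤ Fintype.card A + 1 := by
  classical
  have h := sum_rank_le_card (fun m => (hρ m).1.isHermitian) horth
  rw [← Finset.add_sum_erase _ _ (Finset.mem_univ m)] at h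
  have h₁ : ∑ _j ∈ Finset.univ.erase m, 1 ≤ ∑ j ∈ Finset.univ.erase m, (ρ j).rank :=
    Finset.sum_le_sum fun j _ => (hρ j).one_le_rank
  rw [Finset.sum_const, Finset.card_erase_of_mem (Finset.mem_univ m), smul_eq_mul, mul_one,
    Finset.card_univ] at h₁
  omega

theorem QECM.IsCorrect.card_le {K : Type*} [MeasurableSpace K] {Q : QECM M K A}
    (hQ : Q.IsCorrect) : Fintype.card M ≤ Fintype.card A := by
  have := Q.isProb
  obtain ⟨k, hk⟩ := hQ.ae_orthogonal.exists
  refine le_trans ?_ (sum_rank_le_card (fun m => (Q.isState k m).1.isHermitian) hk)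
  rw [Fintype.card_eq_sum_ones]
  exact Finset.sum_le_sum fun m _ => (Q.isState k m).one_le_rank

/-- Ciphertexts of a correct encryption are diagonalized in blocks by unitaries that depend
measurably on the key. -/
theorem QECM.IsCorrect.exists_measurable_block_diagonal {K : Type*} [MeasurableSpace K]
    {Q : QECM M K A} (hQ : Q.IsCorrect) {d : ℕ}
    (e : M × Fin (Fintype.card A - Fintype.card M + 1) ≃ Fin d)
    {V : Matrix (Fin d) A ℂ} (hV : Vᴴ * V = 1) :
    ∃ W : K → unitaryGroup (Fin d) ℂ, Measurable W ∧ ∀ᵐ k ∂Q.keyDist,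
      ∀ m i j, ¬(i = j ∧ (e.symm i).1 = m) →
        ((W k : Matrix (Fin d) (Fin d) ℂ)ᴴ * (V * Q.cipher k m * Vᴴ) *
          (W k : Matrix (Fin d) (Fin d) ℂ)) i j = 0 := by
  -- The relation lives over tuples of ciphertexts rather than over keys: the key space has no
  -- topology, whereas here the relation is closed. Composing with the measurable map from keys to
  -- ciphertexts comes afterwards.
  let R : Set ((M → A → A → ℂ) × unitaryGroup (Fin d) ℂ) :=
    {p | ∀ m i j, ¬(i = j ∧ (e.symm i).1 = m) →
      ((p.2 : Matrix (Fin d) (Fin d) ℂ)ᴴ * (V * Matrix.of (p.1 m) * Vᴴ) *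
        (p.2 : Matrix (Fin d) (Fin d) ℂ)) i j = 0}
  have hR : IsClosed R := by
    simp only [R, Set.ofPred_forall]
    refine isClosed_iInter fun m => isClosed_iInter fun i => isClosed_iInter fun j =>
      isClosed_iInter fun _ => isClosed_eq ?_ continuous_const
    have hU : Continuous fun p : (M → A → A → ℂ) × unitaryGroup (Fin d) ℂ =>
        (p.2 : Matrix (Fin d) (Fin d) ℂ) := continuous_subtype_val.comp continuous_snd
    have hX : Continuous fun p : (M → A → A → ℂ) × unitaryGroup (Fin d) ℂ =>
        (Matrix.of (p.1 m) : Matrix A A ℂ) :=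
      continuous_matrix fun a a' => by
        simp only [Matrix.of_apply]
        fun_prop
    exact ((hU.matrix_conjTranspose.matrix_mul
      ((continuous_const.matrix_mul hX).matrix_mul continuous_const)).matrix_mul hU).matrix_elem i j
  let l : List (unitaryGroup (Fin d) ℂ → ℝ) :=
    (Finset.univ : Finset (Fin d × Fin d)).toList.flatMap fun p =>
      [fun U => ((U : Matrix (Fin d) (Fin d) ℂ) p.1 p.2).re,
        fun U => ((U : Matrix (Fin d) (Fin d) ℂ) p.1 p.2).im]
  have hl : ∀ f ∈ l, Continuous f := by
    intro f hf
    simp only [l, List.mem_flatMap, List.mem_cons, List.not_mem_nil, or_false] at hf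
    obtain ⟨p, -, rfl | rfl⟩ := hf
    · exact Complex.continuous_re.comp (continuous_subtype_val.matrix_elem p.1 p.2)
    · exact Complex.continuous_im.comp (continuous_subtype_val.matrix_elem p.1 p.2)
  have hsep (U U' : unitaryGroup (Fin d) ℂ) (h : ∀ f ∈ l, f U = f U') : U = U' := by
    ext i j
    refine Complex.ext (h (fun U => ((U : Matrix (Fin d) (Fin d) ℂ) i j).re) ?_)
      (h (fun U => ((U : Matrix (Fin d) (Fin d) ℂ) i j).im) ?_) <;>
    exact List.mem_flatMap.mpr ⟨(i, j), by simp, by simp⟩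
  obtain ⟨S, hS, hSR⟩ := exists_measurable_selection l hl hsep hR
  refine ⟨fun k => S fun m a a' => Q.cipher k m a a', hS.comp ?_, ?_⟩
  · exact measurable_pi_lambda _ fun m => measurable_pi_lambda _ fun a =>
      measurable_pi_lambda _ fun a' => Q.measurable_cipher m a a'
  · filter_upwards [hQ.ae_orthogonal] with k hk
    refine hSR (fun m a a' => Q.cipher k m a a') ?_
    obtain ⟨W, hW, h⟩ := exists_unitary_block_diagonal e (τ := fun m => V * Q.cipher k m * Vᴴ)
      (fun m => ((Q.isState k m).1.mul_mul_conjTranspose_same V).isHermitian)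
      (fun m m' hm => by
        rw [show V * Q.cipher k m * Vᴴ * (V * Q.cipher k m' * Vᴴ) =
          V * (Q.cipher k m * (Vᴴ * V) * Q.cipher k m') * Vᴴ by simp only [Matrix.mul_assoc],
          hV, Matrix.mul_one, hk m m' hm, Matrix.mul_zero, Matrix.zero_mul])
      (fun m => by
        have h₁ := (rank_mul_le_left (V * Q.cipher k m) Vᴴ).trans
          (rank_mul_le_right V (Q.cipher k m))
        have h₂ := card_add_rank_le (Q.isState k) hk m
        have h₃ := hQ.card_le
        omega)
    exact ⟨⟨W, hW⟩, h⟩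

end Correct

/-! ### Transport of attacks -/

section Transport

variable {M M' K K' : Type*} [MeasurableSpace K] [MeasurableSpace K'] {A A' : Type} [Fintype A]
  [Fintype A'] {F : ChannelClass} {N s : ℕ}

/-- The attack that embeds the codespace by `V`, relabels the messages by `φ` and runs `𝒜` with the
key `g k` in place of `k`. -/
def Attack.transport [DecidableEq A] (𝒜 : Attack M' K' A' F N s)
    (hF : F.ClosedUnderIsometries) (φ : M ≃ M') {g : K → K'} (hg : Measurable g)
    (V : Matrix A' A ℂ) (hV : Vᴴ * V = 1) : Attack M K A F N s where
  M₀ := 𝒜.M₀.map φ.symm.toEmbedding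
  card_M₀ := (Finset.card_map _).trans 𝒜.card_M₀
  B := 𝒜.B
  fintypeB := 𝒜.fintypeB
  decEqB := 𝒜.decEqB
  P i k m := 𝒜.P i (g k) (φ.subtypeEquiv (q := (· ∈ 𝒜.M₀)) (by simp) m)
  isPOVM i k := by
    let := 𝒜.fintypeB
    let := 𝒜.decEqB
    refine ⟨fun m => (𝒜.isPOVM i (g k)).1 _, ?_⟩
    rw [← (𝒜.isPOVM i (g k)).2]
    exact Equiv.sum_comp _ (𝒜.P i (g k))
  measurable_P i m b b' :=
    (𝒜.measurable_P i (φ.subtypeEquiv (q := (· ∈ 𝒜.M₀)) (by simp) m) b b').comp hg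
  Φ := letI := 𝒜.fintypeB; 𝒜.Φ.preIsometry V hV
  mem := letI := 𝒜.fintypeB; hF _ _ _ 𝒜.Φ V hV 𝒜.mem

theorem Attack.score_transport [DecidableEq A] (𝒜 : Attack M' K' A' F N s)
    (hF : F.ClosedUnderIsometries) (φ : M ≃ M') {g : K → K'} (hg : Measurable g)
    (V : Matrix A' A ℂ) (hV : Vᴴ * V = 1) (k : K) (ρ : M → Matrix A A ℂ) :
    (𝒜.transport hF φ hg V hV).score k ρ =
      𝒜.score (g k) fun m => V * ρ (φ.symm m) * Vᴴ := by
  let := 𝒜.fintypeB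
  unfold Attack.score
  congr 1
  refine Fintype.sum_equiv (φ.subtypeEquiv (q := (· ∈ 𝒜.M₀)) (by simp [transport])) _ _
    fun m => ?_
  simp only [Equiv.subtypeEquiv_apply, Equiv.symm_apply_apply]
  rfl

theorem Attack.score_sum (𝒜 : Attack M K A F N s) (k : K) {ι : Type*} [Fintype ι]
    (ρ : ι → M → Matrix A A ℂ) :
    𝒜.score k (fun m => ∑ t, ρ t m) = ∑ t, 𝒜.score k (ρ t) := by
  simp only [Attack.score, map_sum, Matrix.mul_sum, Finset.mul_sum, Matrix.trace_sum, Complex.re_sum]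
  rw [Finset.sum_comm]

theorem Attack.score_smul (𝒜 : Attack M K A F N s) (k : K) (c : ℝ) (ρ : M → Matrix A A ℂ) :
    𝒜.score k (fun m => (c : ℂ) • ρ m) = c * 𝒜.score k ρ := by
  simp only [Attack.score, map_smul, Matrix.mul_smul, Matrix.trace_smul, smul_eq_mul,
    Complex.re_ofReal_mul, ← Finset.mul_sum]
  ring

theorem Attack.measurable_score (𝒜 : Attack M K A F N s) {Z : Type*} [MeasurableSpace Z]
    {g : Z → K} (hg : Measurable g) {ρ : Z → M → Matrix A A ℂ}
    (hρ : ∀ m a a', Measurable fun z => ρ z m a a') :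
    Measurable fun z => 𝒜.score (g z) (ρ z) := by
  classical
  let := 𝒜.fintypeB
  have hΦ (m : M) (x y) : Measurable fun z => 𝒜.Φ.toLin (ρ z m) x y := by
    -- By linearity, each entry of the output is a fixed linear combination of the entries of the
    -- input.
    have h (z : Z) : 𝒜.Φ.toLin (ρ z m) x y =
        ∑ a, ∑ a', ρ z m a a' * 𝒜.Φ.toLin (Matrix.single a a' 1) x y := by
      conv_lhs => rw [matrix_eq_sum_single (ρ z m)]
      simp only [map_sum, Matrix.sum_apply]
      refine Finset.sum_congr rfl fun a _ => Finset.sum_congr rfl fun a' _ => ?_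
      rw [← mul_one (ρ z m a a'), ← smul_eq_mul, ← Matrix.smul_single, map_smul, smul_eq_mul,
        mul_one, Matrix.smul_apply, smul_eq_mul]
    simp only [h]
    exact Finset.measurable_fun_sum _ fun a _ => Finset.measurable_fun_sum _ fun a' _ =>
      (hρ m a a').mul_const _
  refine (Finset.measurable_fun_sum _ fun m _ => Complex.measurable_re.comp ?_).const_mul _
  simp only [Matrix.trace, Matrix.diag, Matrix.mul_apply, tensor, Matrix.of_apply]
  refine Finset.measurable_fun_sum _ fun x _ => Finset.measurable_fun_sum _ fun y _ =>
    Measurable.mul (Finset.measurable_fun_prod _ fun i _ => ?_) (hΦ m y x)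
  exact (𝒜.measurable_P i m _ _).comp hg

theorem Attack.integrable_score (𝒜 : Attack M K A F N s) {Z : Type*} [MeasurableSpace Z]
    (μ : Measure Z) [IsFiniteMeasure μ] {g : Z → K} (hg : Measurable g)
    {ρ : Z → M → Matrix A A ℂ} (hρ : ∀ m a a', Measurable fun z => ρ z m a a')
    (hstate : ∀ z m, IsState (ρ z m)) : Integrable (fun z => 𝒜.score (g z) (ρ z)) μ :=
  Integrable.of_bound (𝒜.measurable_score hg hρ).aestronglyMeasurable 1
    (.of_forall fun z => 𝒜.score_norm_le _ (hstate z))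

end Transport

/-! ### Averaging over cyclic shifts of the blocks -/

section Shift

variable {r n : ℕ}

/-- The position of the `t`-th basis vector of the `i`-th block. -/
def blockEquiv (r n : ℕ) : Fin n × Fin r ≃ Fin (r * n) :=
  finProdFinEquiv.trans (finCongr (Nat.mul_comm n r))

theorem blockState_eq (i : Fin n) :
    blockState r n i =
      Matrix.diagonal fun j => if ((blockEquiv r n).symm j).1 = i then (r : ℂ)⁻¹ else 0 := by
  refine congrArg Matrix.diagonal (funext fun j => ?_)
  obtain ⟨⟨i', t⟩, rfl⟩ := (blockEquiv r n).surjective j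
  rw [Equiv.symm_apply_apply]
  refine if_congr ?_ rfl rfl
  have hj : (blockEquiv r n (i', t)).val = t.val + r * i'.val := rfl
  have ht := t.isLt
  rw [hj, Fin.ext_iff]
  constructor
  · rintro ⟨h₁, h₂⟩
    have h₃ : i.val < i'.val + 1 := by
      by_contra! h
      have := Nat.mul_le_mul_left r h
      rw [Nat.mul_add] at this
      omega
    have h₄ : i'.val < i.val + 1 := by
      by_contra! h
      have := Nat.mul_le_mul_left r h
      omega
    change i'.val = i.val
    omega
  · intro h
    change i'.val = i.val at h
    rw [h, Nat.mul_add]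
    omega

/-- The cyclic shift by `t` of the basis vectors of each block. -/
def blockShift [NeZero r] (n : ℕ) (t : Fin r) : Equiv.Perm (Fin (r * n)) :=
  (blockEquiv r n).permCongr ((Equiv.refl _).prodCongr (Equiv.addRight t))

/-- As t varies, each diagonal position of the block sees every diagonal entry once, so the sum
there is the trace, 1. -/
theorem sum_submatrix_blockShift [NeZero r] {i : Fin n} {D : Matrix (Fin (r * n)) (Fin (r * n)) ℂ}
    (hD : ∀ j j', ¬(j = j' ∧ ((blockEquiv r n).symm j).1 = i) → D j j' = 0)
    (htr : D.trace = 1) :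
    ∑ t : Fin r, D.submatrix (blockShift n t) (blockShift n t) = (r : ℂ) • blockState r n i := by
  have hr : (r : ℂ) ≠ 0 := Nat.cast_ne_zero.mpr (NeZero.ne r)
  have htr' : ∑ u : Fin r, D (blockEquiv r n (i, u)) (blockEquiv r n (i, u)) = 1 := by
    rw [← htr, Matrix.trace, ← (blockEquiv r n).sum_comp, Fintype.sum_prod_type,
      Finset.sum_eq_single i]
    · rfl
    · intro i' _ hi
      exact Finset.sum_eq_zero fun u _ => hD _ _ (by simp [hi])
    · simp
  rw [blockState_eq]
  ext j j'
  obtain ⟨⟨i', u⟩, rfl⟩ := (blockEquiv r n).surjective j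
  rw [Matrix.sum_apply, Matrix.smul_apply, smul_eq_mul, Matrix.diagonal_apply]
  simp only [Matrix.submatrix_apply]
  by_cases hj : blockEquiv r n (i', u) = j'
  · subst hj
    rw [if_pos rfl, Equiv.symm_apply_apply]
    simp only [blockShift, Equiv.permCongr_apply, Equiv.symm_apply_apply, Equiv.prodCongr_apply,
      Prod.map_apply, Equiv.refl_apply, Equiv.coe_addRight]
    by_cases hi : i' = i
    · subst hi
      rw [if_pos rfl, mul_inv_cancel₀ hr, ← htr']
      exact Equiv.sum_comp (Equiv.addLeft u) fun v =>
        D (blockEquiv r n (i', v)) (blockEquiv r n (i', v))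
    · rw [if_neg hi, mul_zero]
      exact Finset.sum_eq_zero fun t _ => hD _ _ (by simp [hi])
  · rw [if_neg hj, mul_zero]
    exact Finset.sum_eq_zero fun t _ =>
      hD _ _ fun h => hj ((blockShift n t).injective h.1)

end Shift

/-! ### Permutation matrices -/

theorem one_submatrix_conj {d : ℕ} (π : Equiv.Perm (Fin d)) (D : Matrix (Fin d) (Fin d) ℂ) :
    (1 : Matrix (Fin d) (Fin d) ℂ).submatrix π id * D *
      ((1 : Matrix (Fin d) (Fin d) ℂ).submatrix π id)ᴴ = D.submatrix π π := by
  ext i j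
  simp [Matrix.mul_apply, Matrix.one_apply]

/-- The unitary of a permutation of the basis vectors. -/
def permUnitary {d : ℕ} (π : Equiv.Perm (Fin d)) : unitaryGroup (Fin d) ℂ :=
  ⟨(1 : Matrix (Fin d) (Fin d) ℂ).submatrix π id, by
    have h := one_submatrix_conj π 1
    rw [Matrix.mul_one, submatrix_one_equiv] at h
    exact mem_unitaryGroup_iff.mpr h⟩

/-! ### The Haar measure -/

instance haarUnitary_isHaarMeasure (d : ℕ) : (haarUnitary d).IsHaarMeasure :=
  inferInstanceAs (Measure.haarMeasure ⊤).IsHaarMeasure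

/-- A right translate of the measure is again a left-invariant probability measure, and uniqueness
makes the two equal. -/
instance haarUnitary_isMulRightInvariant (d : ℕ) : (haarUnitary d).IsMulRightInvariant where
  map_mul_right_eq_self g := by
    have : IsProbabilityMeasure ((haarUnitary d).map (· * g)) :=
      Measure.isProbabilityMeasure_map (measurable_mul_const g).aemeasurable
    exact Measure.isHaarMeasure_eq_of_isProbabilityMeasure _ _

/-- Makes multiplication jointly measurable for the product σ-algebra, as the Fubini step requires.
-/
instance unitarySecondCountableTopology (d : ℕ) :
    SecondCountableTopology (unitaryGroup (Fin d) ℂ) :=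
  have : SecondCountableTopology (Matrix (Fin d) (Fin d) ℂ) :=
    inferInstanceAs (SecondCountableTopology (Fin d → Fin d → ℂ))
  TopologicalSpace.Subtype.secondCountableTopology _

/-! ### Reduction of attacks on the Haar-measure encryption -/

theorem IsState.conj {A A' : Type} [Fintype A] [DecidableEq A] [Fintype A'] {ρ : Matrix A A ℂ}
    (hρ : IsState ρ) {V : Matrix A' A ℂ} (hV : Vᴴ * V = 1) : IsState (V * ρ * Vᴴ) := by
  refine ⟨hρ.1.mul_mul_conjTranspose_same V, ?_⟩
  rw [Matrix.trace_mul_comm, ← Matrix.mul_assoc, hV, Matrix.one_mul, hρ.2]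

theorem exists_isometry {A A' : Type*} [Fintype A] [DecidableEq A] [Fintype A'] [DecidableEq A']
    (h : Fintype.card A ≤ Fintype.card A') : ∃ V : Matrix A' A ℂ, Vᴴ * V = 1 := by
  obtain ⟨f⟩ := Function.Embedding.nonempty_of_card_le h
  refine ⟨(1 : Matrix A' A' ℂ).submatrix id f, ?_⟩
  rw [conjTranspose_submatrix, conjTranspose_one, ← submatrix_mul _ _ _ _ _ Function.bijective_id,
    Matrix.mul_one, submatrix_one_embedding]

theorem measurable_conj_apply {A A' Z : Type*} [Fintype A] [MeasurableSpace Z]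
    {X : Z → Matrix A' A ℂ} {Y : Z → Matrix A A ℂ} (hX : ∀ i j, Measurable fun z => X z i j)
    (hY : ∀ i j, Measurable fun z => Y z i j) (i j : A') :
    Measurable fun z => (X z * Y z * (X z)ᴴ) i j := by
  simp only [Matrix.mul_apply, Matrix.conjTranspose_apply]
  exact Finset.measurable_fun_sum _ fun a _ =>
    (Finset.measurable_fun_sum _ fun b _ => (hX i b).mul (hY b a)).mul
      (continuous_star.measurable.comp (hX j a))

theorem measurable_unitary_apply {d : ℕ} (i j : Fin d) :
    Measurable fun U : unitaryGroup (Fin d) ℂ => (U : Matrix (Fin d) (Fin d) ℂ) i j :=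
  (continuous_subtype_val.matrix_elem i j).measurable

theorem unitary_conjTranspose_mul_self {d : ℕ} (U : unitaryGroup (Fin d) ℂ) :
    (U : Matrix (Fin d) (Fin d) ℂ)ᴴ * (U : Matrix (Fin d) (Fin d) ℂ) = 1 :=
  mem_unitaryGroup_iff'.mp U.2

theorem unitary_mul_conjTranspose_self {d : ℕ} (U : unitaryGroup (Fin d) ℂ) :
    (U : Matrix (Fin d) (Fin d) ℂ) * (U : Matrix (Fin d) (Fin d) ℂ)ᴴ = 1 :=
  mem_unitaryGroup_iff.mp U.2

section Reduction

variable {F : ChannelClass} {N s : ℕ}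

/-- Running an attack on the Haar-measure encryption with the keys that diagonalize the states
`τ i` in blocks, shifted cyclically, yields its value on average. -/
theorem sum_integral_score_eq {r n : ℕ} [NeZero r]
    (𝒜 : Attack (Fin n) (unitaryGroup (Fin (r * n)) ℂ) (Fin (r * n)) F N s)
    {τ : Fin n → Matrix (Fin (r * n)) (Fin (r * n)) ℂ} (hτ : ∀ i, IsState (τ i))
    (W : unitaryGroup (Fin (r * n)) ℂ)
    (hW : ∀ i j j', ¬(j = j' ∧ ((blockEquiv r n).symm j).1 = i) →
      ((W : Matrix (Fin (r * n)) (Fin (r * n)) ℂ)ᴴ * τ i *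
        (W : Matrix (Fin (r * n)) (Fin (r * n)) ℂ)) j j' = 0) :
    ∑ t : Fin r, ∫ U : unitaryGroup (Fin (r * n)) ℂ,
        𝒜.score (U * (W * (permUnitary (blockShift n t))⁻¹)) (fun i =>
          (U : Matrix (Fin (r * n)) (Fin (r * n)) ℂ) * τ i *
            (U : Matrix (Fin (r * n)) (Fin (r * n)) ℂ)ᴴ) ∂haarUnitary (r * n) =
      r * (haarEncryption r n).attackValue 𝒜 := by
  let D (i : Fin n) : Matrix (Fin (r * n)) (Fin (r * n)) ℂ :=
    (W : Matrix (Fin (r * n)) (Fin (r * n)) ℂ)ᴴ * τ i * (W : Matrix (Fin (r * n)) (Fin (r * n)) ℂ)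
  have hD (i : Fin n) : IsState (D i) := by
    have h := (hτ i).conj (V := (W : Matrix (Fin (r * n)) (Fin (r * n)) ℂ)ᴴ)
      (by rw [conjTranspose_conjTranspose, unitary_mul_conjTranspose_self])
    rwa [conjTranspose_conjTranspose] at h
  let D' (t : Fin r) (i : Fin n) : Matrix (Fin (r * n)) (Fin (r * n)) ℂ :=
    (D i).submatrix (blockShift n t) (blockShift n t)
  have hD'_eq (t : Fin r) (i : Fin n) :
      D' t i = (permUnitary (blockShift n t) : Matrix (Fin (r * n)) (Fin (r * n)) ℂ) * D i *
        (permUnitary (blockShift n t) : Matrix (Fin (r * n)) (Fin (r * n)) ℂ)ᴴ :=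
    (one_submatrix_conj _ _).symm
  have hD' (t : Fin r) (i : Fin n) : IsState (D' t i) := by
    rw [hD'_eq]
    exact (hD i).conj (unitary_conjTranspose_mul_self _)
  let h (t : Fin r) (U : unitaryGroup (Fin (r * n)) ℂ) : ℝ :=
    𝒜.score U fun i => (U : Matrix (Fin (r * n)) (Fin (r * n)) ℂ) * D' t i *
      (U : Matrix (Fin (r * n)) (Fin (r * n)) ℂ)ᴴ
  have hint (t : Fin r) : Integrable (h t) (haarUnitary (r * n)) := by
    exact 𝒜.integrable_score _ measurable_id
      (fun i => measurable_conj_apply (fun j j' => measurable_unitary_apply j j')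
        fun _ _ => measurable_const)
      fun U i => (hD' t i).conj (unitary_conjTranspose_mul_self U)
  -- Seen from the key U W T⁻¹, with T the shift unitary, the state U τ U* is an encryption of T W*
  -- τ W T*, a shifted diagonal state.
  have hshift (t : Fin r) (U : unitaryGroup (Fin (r * n)) ℂ) :
      𝒜.score (U * (W * (permUnitary (blockShift n t))⁻¹)) (fun i =>
          (U : Matrix (Fin (r * n)) (Fin (r * n)) ℂ) * τ i *
            (U : Matrix (Fin (r * n)) (Fin (r * n)) ℂ)ᴴ) =
        h t (U * (W * (permUnitary (blockShift n t))⁻¹)) := by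
    refine congrArg (𝒜.score _) (funext fun i => ?_)
    let T := permUnitary (blockShift n t)
    have hT : ((T⁻¹ : unitaryGroup (Fin (r * n)) ℂ) : Matrix (Fin (r * n)) (Fin (r * n)) ℂ) =
        (T : Matrix (Fin (r * n)) (Fin (r * n)) ℂ)ᴴ := rfl
    have hTT := unitary_conjTranspose_mul_self T
    have hWW := unitary_mul_conjTranspose_self W
    rw [hD'_eq]
    change _ = ((U * (W * T⁻¹) : unitaryGroup (Fin (r * n)) ℂ) : Matrix _ _ ℂ) *
      ((T : Matrix _ _ ℂ) * ((W : Matrix _ _ ℂ)ᴴ * τ i * (W : Matrix _ _ ℂ)) *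
        (T : Matrix _ _ ℂ)ᴴ) * ((U * (W * T⁻¹) : unitaryGroup (Fin (r * n)) ℂ) : Matrix _ _ ℂ)ᴴ
    simp only [Submonoid.coe_mul, hT, conjTranspose_mul, conjTranspose_conjTranspose]
    generalize (U : Matrix (Fin (r * n)) (Fin (r * n)) ℂ) = U' at *
    generalize (W : Matrix (Fin (r * n)) (Fin (r * n)) ℂ) = W' at *
    generalize (T : Matrix (Fin (r * n)) (Fin (r * n)) ℂ) = T' at *
    have hcalc : U' * (W' * T'ᴴ) * (T' * (W'ᴴ * τ i * W') * T'ᴴ) * (T' * W'ᴴ * U'ᴴ) =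
        U' * (W' * (T'ᴴ * T') * W'ᴴ) * τ i * (W' * (T'ᴴ * T') * W'ᴴ) * U'ᴴ := by
      simp only [Matrix.mul_assoc]
    rw [hcalc, hTT, Matrix.mul_one, hWW, Matrix.mul_one, Matrix.mul_one]
  have hsum (U : unitaryGroup (Fin (r * n)) ℂ) :
      ∑ t, h t U = r * 𝒜.score U ((haarEncryption r n).cipher U) := by
    rw [← 𝒜.score_sum, ← 𝒜.score_smul]
    refine congrArg (𝒜.score _) (funext fun i => ?_)
    rw [← Finset.sum_mul, ← Finset.mul_sum,
      sum_submatrix_blockShift (hW i) (hD i).2, Matrix.mul_smul, Matrix.smul_mul]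
    simp [haarEncryption]
  calc _ = ∑ t, ∫ U, h t U ∂haarUnitary (r * n) := by
        refine Finset.sum_congr rfl fun t _ => ?_
        -- The factor W T⁻¹ does not depend on U, so right invariance absorbs it.
        rw [← integral_mul_right_eq_self (h t) (W * (permUnitary (blockShift n t))⁻¹)]
        exact integral_congr_ae (.of_forall fun U => hshift t U)
    _ = ∫ U, ∑ t, h t U ∂haarUnitary (r * n) := (integral_finsetSum _ fun t _ => hint t).symm
    _ = _ := by
        simp only [hsum]
        rw [integral_const_mul]
        rfl

theorem QECM.IsCorrect.haar_attackValue_le {M K : Type*} [Fintype M] [Nonempty M]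
    [MeasurableSpace K] {A : Type} [Fintype A] [DecidableEq A] {Q : QECM M K A}
    (hQ : Q.IsCorrect) (hF : F.ClosedUnderIsometries) {r n : ℕ} [NeZero r]
    (hr : r = Fintype.card A - Fintype.card M + 1) (hn : n = Fintype.card M)
    (𝒜 : Attack (Fin n) (unitaryGroup (Fin (r * n)) ℂ) (Fin (r * n)) F N s) :
    (haarEncryption r n).attackValue 𝒜 ≤ Q.cloningValue F N s := by
  have := Q.isProb
  have hcard := hQ.card_le
  obtain ⟨φ⟩ : Nonempty (M ≃ Fin n) := ⟨(Fintype.equivFin M).trans (finCongr hn.symm)⟩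
  obtain ⟨V, hV⟩ : ∃ V : Matrix (Fin (r * n)) A ℂ, Vᴴ * V = 1 := by
    refine exists_isometry ?_
    rw [Fintype.card_fin, hr, hn]
    have hpos : 1 ≤ Fintype.card M := Fintype.card_pos
    -- With a = dim H ≥ n ≥ 1, this gives (a - n + 1) n ≥ (a - n) + n = a, the room needed for the
    -- isometry.
    have h := Nat.mul_le_mul_left (Fintype.card A - Fintype.card M) hpos
    rw [Nat.add_mul]
    omega
  obtain ⟨W, hWmeas, hW⟩ := hQ.exists_measurable_block_diagonal
    ((φ.prodCongr (finCongr hr.symm)).trans (blockEquiv r n)) hV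
  let T (t : Fin r) : unitaryGroup (Fin (r * n)) ℂ := (permUnitary (blockShift n t))⁻¹
  let τ (k : K) (i : Fin n) : Matrix (Fin (r * n)) (Fin (r * n)) ℂ :=
    V * Q.cipher k (φ.symm i) * Vᴴ
  have hτ (k : K) (i : Fin n) : IsState (τ k i) := (Q.isState k _).conj hV
  let f (t : Fin r) (k : K) (U : unitaryGroup (Fin (r * n)) ℂ) : ℝ :=
    𝒜.score (U * (W k * T t)) fun i => (U : Matrix (Fin (r * n)) (Fin (r * n)) ℂ) * τ k i *
      (U : Matrix (Fin (r * n)) (Fin (r * n)) ℂ)ᴴ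
  have hint (t : Fin r) : Integrable (Function.uncurry (f t))
      (Q.keyDist.prod (haarUnitary (r * n))) := by
    have hg : Measurable fun z : K × unitaryGroup (Fin (r * n)) ℂ => z.2 * (W z.1 * T t) :=
      measurable_snd.mul ((hWmeas.comp measurable_fst).mul_const _)
    have hτ_meas (i : Fin n) (l l' : Fin (r * n)) : Measurable fun k => τ k i l l' :=
      measurable_conj_apply (X := fun _ : K => V) (Y := fun k => Q.cipher k (φ.symm i))
        (fun _ _ => measurable_const) (Q.measurable_cipher (φ.symm i)) l l'
    have hρ (i : Fin n) (j j' : Fin (r * n)) :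
        Measurable fun z : K × unitaryGroup (Fin (r * n)) ℂ =>
          ((z.2 : Matrix (Fin (r * n)) (Fin (r * n)) ℂ) * τ z.1 i *
            (z.2 : Matrix (Fin (r * n)) (Fin (r * n)) ℂ)ᴴ) j j' :=
      measurable_conj_apply (X := fun z : K × unitaryGroup (Fin (r * n)) ℂ =>
          (z.2 : Matrix (Fin (r * n)) (Fin (r * n)) ℂ)) (Y := fun z => τ z.1 i)
        (fun l l' => (measurable_unitary_apply l l').comp measurable_snd)
        (fun l l' => (hτ_meas i l l').comp measurable_fst) j j'
    have h := 𝒜.integrable_score (Q.keyDist.prod (haarUnitary (r * n))) hg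
      (ρ := fun z i => (z.2 : Matrix (Fin (r * n)) (Fin (r * n)) ℂ) * τ z.1 i *
        (z.2 : Matrix (Fin (r * n)) (Fin (r * n)) ℂ)ᴴ) hρ
      fun z i => (hτ z.1 i).conj (unitary_conjTranspose_mul_self z.2)
    exact h
  -- For fixed t and U this is the value of a genuine attack on Q: the channel is precomposed with
  -- the isometry UV, and k enters only the receivers' key.
  have hle (t : Fin r) (U : unitaryGroup (Fin (r * n)) ℂ) :
      ∫ k, f t k U ∂Q.keyDist ≤ Q.cloningValue F N s := by
    have hUV : ((U : Matrix (Fin (r * n)) (Fin (r * n)) ℂ) * V)ᴴ *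
        ((U : Matrix (Fin (r * n)) (Fin (r * n)) ℂ) * V) = 1 := by
      rw [conjTranspose_mul, Matrix.mul_assoc, ← Matrix.mul_assoc _ _ V,
        unitary_conjTranspose_mul_self, Matrix.one_mul, hV]
    have hg : Measurable fun k => U * (W k * T t) := (hWmeas.mul_const _).const_mul _
    refine le_of_eq_of_le ?_ (Q.attackValue_le_cloningValue (𝒜.transport hF φ hg _ hUV))
    rw [Q.attackValue_eq]
    refine integral_congr_ae (.of_forall fun k => ?_)
    simp only [𝒜.score_transport]
    refine congrArg (𝒜.score _) (funext fun i => ?_)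
    simp only [τ, conjTranspose_mul, Matrix.mul_assoc]
  have hr0 : (0 : ℝ) < r := Nat.cast_pos.mpr (Nat.pos_of_ne_zero (NeZero.ne r))
  refine le_of_mul_le_mul_left ?_ hr0
  calc (r : ℝ) * (haarEncryption r n).attackValue 𝒜
      = ∫ _k, (r : ℝ) * (haarEncryption r n).attackValue 𝒜 ∂Q.keyDist := by simp
    _ = ∫ k, ∑ t, ∫ U, f t k U ∂haarUnitary (r * n) ∂Q.keyDist := by
        refine integral_congr_ae ?_
        filter_upwards [hW] with k hk
        refine (sum_integral_score_eq 𝒜 (hτ k) (W k) fun i j j' hj => ?_).symm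
        refine hk (φ.symm i) j j' fun h => hj ⟨h.1, ?_⟩
        have h₂ := h.2
        simpa [Equiv.symm_apply_eq] using h₂
    _ = ∑ t, ∫ k, ∫ U, f t k U ∂haarUnitary (r * n) ∂Q.keyDist :=
        integral_finsetSum _ fun t _ => (hint t).integral_prod_left
    _ = ∑ t, ∫ U, ∫ k, f t k U ∂Q.keyDist ∂haarUnitary (r * n) :=
        Finset.sum_congr rfl fun t _ => integral_integral_swap (hint t)
    _ ≤ ∑ _t : Fin r, Q.cloningValue F N s := by
        refine Finset.sum_le_sum fun t _ => ?_
        refine (integral_mono (hint t).integral_prod_right (integrable_const _) (hle t)).trans ?_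
        simp
    _ = r * Q.cloningValue F N s := by simp

end Reduction

end

end QEnc

theorem mainTheorem9 {M K : Type*} [Fintype M] [MeasurableSpace K]
    {A : Type} [Fintype A] [DecidableEq A]
    (Q : QEnc.QECM M K A) (hQ : Q.IsCorrect)
    (F : QEnc.ChannelClass) (hF : F.ClosedUnderIsometries) (N s : ℕ) :
    (QEnc.haarEncryption (Fintype.card A - Fintype.card M + 1) (Fintype.card M)).cloningValue F N s
      ≤ Q.cloningValue F N s := by
  refine Real.iSup_le (fun 𝒜 => ?_) Q.cloningValue_nonneg
  -- Without messages the Haar codespace is zero-dimensional and the embedding of H may fail to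
  -- exist, but then every attack has value 0.
  rcases isEmpty_or_nonempty M with hM | hM
  · have hempty : IsEmpty 𝒜.M₀ := ⟨fun i => hM.false ((Fintype.equivFin M).symm i)⟩
    refine le_of_eq_of_le ?_ Q.cloningValue_nonneg
    simp [QEnc.QECM.attackValue]
  · exact hQ.haar_attackValue_le hF rfl rfl 𝒜
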